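/- A pseudoline in the Euclidean plane $\mathbb{E}$ is the image of a straight line under a homeomorphism of $\mathbb{E}$ onto itself. An arrangement is a finite set of pseudolines in $\mathbb{E}$ any two of which have exactly one common point and cross there; it is simple if no point lies on more than two of its pseudolines; any subset of it is called a subarrangement. The polygons of an arrangement are the bounded connected components of the complement of the union of its pseudolines. The edges of an arrangement are the (open) arcs into which its pseudolines are divided by their crossings; the edges of a polygon are those that lie on its boundary, and an $n$-gon is a polygon with exactly $n$ edges; a $(\ge 5)$-gon is an $n$-gon with $n\ge 5$. Two distinct edges of a polygon are adjacent if they have a common endpoint. A pseudoline crosses an edge if it does not contain the edge but meets it at a point that is not an endpoint of the edge. Lemma. Let $\mathcal{L}$ be a simple arrangement of pseudolines in the Euclidean plane and let $\mathcal{M}\subseteq\mathcal{L}$ be a subarrangement. Let $Q$ be a $(\ge 5)$-gon of $\mathcal{M}$ and let $w$ be an edge of $Q$ (as a polygon of $\mathcal{M}$) such that no pseudoline of $\mathcal{L}$ crosses $w$. Then for every edge $q$ of $Q$ that is adjacent to $w$ there is a $(\ge 5)$-gon $R$ of $\mathcal{L}$ with $R\subseteq Q$ such that some edge of $R$ is a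 subarc of $q$. -/

import Mathlib

namespace PseudolineArrangement

/-- The Euclidean plane. -/
abbrev Plane : Type := EuclideanSpace ℝ (Fin 2)

/-- A pseudoline of the Euclidean plane: the image of a straight line under a homeomorphism of the
plane onto itself. (These are exactly the traces on `ℙ \ p₀`, identified with the plane, of the
simple noncontractible closed curves of the projective plane `ℙ` that cross the pseudoline `p₀`
exactly once; equivalently, the properly embedded copies of `ℝ`.) -/
def IsPseudoline (p : Set Plane) : Prop :=
  ∃ h : Plane ≃ₜ Plane, p = h '' {x : Plane | x 1 = 0}

/-- `a` and `b` are points off `p` that lie in different connected components of the complement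
of `p`. -/
def OnOppositeSides (p : Set Plane) (a b : Plane) : Prop :=
  a ∉ p ∧ b ∉ p ∧ b ∉ connectedComponentIn pᶜ a

/-- `p` and `q` have exactly one common point, and `q` passes there from one side of `p` to the
other (it has points on both sides of `p`). -/
def CrossExactlyOnce (p q : Set Plane) : Prop :=
  (∃ v, p ∩ q = {v}) ∧ ∃ a ∈ q, ∃ b ∈ q, OnOppositeSides p a b

/-- A Euclidean arrangement of pseudolines: a finite collection of pseudolines of the plane, any
two of which cross exactly once. -/
structure IsArrangement (L : Set (Set Plane)) : Prop where
  finite : L.Finite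
  pseudoline : ∀ p ∈ L, IsPseudoline p
  cross : L.Pairwise CrossExactlyOnce

/-- A simple Euclidean arrangement: no point belongs to more than two pseudolines. -/
structure IsSimpleArrangement (L : Set (Set Plane)) : Prop extends IsArrangement L where
  simple : ∀ x : Plane, {p ∈ L | x ∈ p}.encard ≤ 2

/-- The (open, two-dimensional) cells of `L`: the connected components of the complement of the
union of the pseudolines. -/
def IsCell (L : Set (Set Plane)) (C : Set Plane) : Prop :=
  ∃ x ∈ (⋃₀ L)ᶜ, C = connectedComponentIn (⋃₀ L)ᶜ x

/-- The edges of `L`, as open arcs: the connected components of what is left of a pseudoline `p`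
of `L` when its crossings with the other pseudolines of `L` are removed. -/
def IsEdge (L : Set (Set Plane)) (e : Set Plane) : Prop :=
  ∃ p ∈ L, ∃ x ∈ p \ ⋃₀ (L \ {p}), e = connectedComponentIn (p \ ⋃₀ (L \ {p})) x

/-- The polygons (faces) of `L`: its bounded open cells. -/
def IsPolygon (L : Set (Set Plane)) (Q : Set Plane) : Prop :=
  IsCell L Q ∧ Bornology.IsBounded Q

/-- The edges of the polygon `Q` of `L`: the edges of `L` that lie on the boundary of `Q`. -/
def edgesOf (L : Set (Set Plane)) (Q : Set Plane) : Set (Set Plane) :=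
  {e | IsEdge L e ∧ e ⊆ frontier Q}

/-- An `n`-gon of `L`: a polygon of `L` with exactly `n` edges. -/
def IsNGon (L : Set (Set Plane)) (n : ℕ) (Q : Set Plane) : Prop :=
  IsPolygon L Q ∧ (edgesOf L Q).encard = n

/-- A `(≥ 5)`-gon of `L`. -/
def IsGeFiveGon (L : Set (Set Plane)) (Q : Set Plane) : Prop :=
  ∃ n : ℕ, 5 ≤ n ∧ IsNGon L n Q

/-- The pseudoline `p` crosses the (open) edge `e`: it has a point on `e` and is not the
pseudoline that carries `e`. -/
def CrossesEdge (p e : Set Plane) : Prop :=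
  (p ∩ e).Nonempty ∧ ¬ e ⊆ p

/-- Two distinct (open) edges are adjacent if they have a common endpoint. -/
def AdjacentEdges (e f : Set Plane) : Prop :=
  e ≠ f ∧ (closure e ∩ closure f).Nonempty

end PseudolineArrangement

namespace PseudolineArrangement

open Topology Set

/-! ### A chart of a pseudoline -/

/-! The proof adds the pseudolines of `L \ M` to `M` while keeping a cell with at least five sides
that has a side on `q` next to an uncrossed side (`Corner.exists_five_le_sides`).

Let `v` be the vertex between the edges on `w` and `q`. Choose a missing pseudoline `p` such that
none crosses the edge on `q` strictly between `p` and `v` (`Corner.exists_nearest`). The part of the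
cell at `v` is again a corner, since nothing crosses the edge on `w` (`Corner.exists_insert`). If
this part has at least five sides, induct. Otherwise `p` meets the cell and crosses exactly two of
its edges (`IsSimpleArrangement.exists_two_crossed_arcs`). These, `p` and `w` already give four
sides, so `p` crosses `q` and one further edge `b`, and the part at `v` is a quadrangle on `p`, `w`,
`q`, `b`.

If nothing crosses the segment of `p` in the cell, the part beyond `p` loses only the side `w` and
gains `p`. It has as many sides as before and an uncrossed side `p` adjacent to `q`. If some `p'`
crosses that segment, it must leave the quadrangle through `b`: `w` is uncrossed and `p` is nearest
on `q`. So `p'` cuts off the corner of `p` and `b`, leaving a pentagon at `v`.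

The topology is reduced to signs of `height`. Cells are sign regions and edges are `arc`s
(`connectedComponentIn_eq_region`, `connectedComponentIn_eq_arc`), because a pseudoline meets every
sign region in an interval and cuts it into connected parts
(`IsPseudoline.isPreconnected_inter_side`). -/

open Classical in
/-- A homeomorphism of the plane that maps the first coordinate axis onto the pseudoline `p`. -/
noncomputable def chart (p : Set Plane) : Plane ≃ₜ Plane :=
  if h : IsPseudoline p then h.choose else Homeomorph.refl _

/-- The signed height over the pseudoline `p`: its sign tells the side of `p`. -/
noncomputable def height (p : Set Plane) (x : Plane) : ℝ := (chart p).symm x 1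

/-- The coordinate along the pseudoline `p`. -/
noncomputable def coord (p : Set Plane) (x : Plane) : ℝ := (chart p).symm x 0

/-- The parametrization of the pseudoline `p`. -/
noncomputable def param (p : Set Plane) (t : ℝ) : Plane := chart p !₂[t, 0]

lemma continuous_height (p : Set Plane) : Continuous (height p) := by
  unfold height; fun_prop

lemma continuous_coord (p : Set Plane) : Continuous (coord p) := by
  unfold coord; fun_prop

lemma continuous_param (p : Set Plane) : Continuous (param p) := by
  unfold param; fun_prop

lemma IsPseudoline.mem_iff {p : Set Plane} (hp : IsPseudoline p) {x : Plane} :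
    x ∈ p ↔ height p x = 0 := by
  have h : p = chart p '' {x : Plane | x 1 = 0} := by
    simp only [chart, dif_pos hp]; exact hp.choose_spec
  unfold height
  conv_lhs => rw [h, Homeomorph.image_eq_preimage_symm]
  rfl

lemma coord_param (p : Set Plane) (t : ℝ) : coord p (param p t) = t := by
  simp [coord, param]

lemma IsPseudoline.param_mem {p : Set Plane} (hp : IsPseudoline p) (t : ℝ) : param p t ∈ p := by
  rw [hp.mem_iff]; simp [height, param]

lemma IsPseudoline.param_coord {p : Set Plane} (hp : IsPseudoline p) {x : Plane} (hx : x ∈ p) :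
    param p (coord p x) = x := by
  rw [hp.mem_iff] at hx
  unfold param coord
  unfold height at hx
  have : !₂[(chart p).symm x 0, 0] = (chart p).symm x := by
    ext i; fin_cases i <;> simp [hx]
  rw [this, Homeomorph.apply_symm_apply]

lemma IsPseudoline.isClosed {p : Set Plane} (hp : IsPseudoline p) : IsClosed p := by
  have : p = height p ⁻¹' {0} := by ext x; exact hp.mem_iff
  rw [this]; exact isClosed_singleton.preimage (continuous_height p)

lemma convex_halfPlane (s : ℝ) : Convex ℝ {x : Plane | 0 < s * x 1} := by
  intro x hx y hy a b ha hb hab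
  simp only [mem_ofPred_eq, PiLp.add_apply, PiLp.smul_apply, smul_eq_mul] at *
  have : s * (a * x 1 + b * y 1) = a * (s * x 1) + b * (s * y 1) := by ring
  rw [this]
  rcases ha.eq_or_lt with rfl | ha
  · simp only [zero_add] at hab; subst hab; simpa using hy
  · positivity

lemma isPreconnected_side (p : Set Plane) (s : ℝ) : IsPreconnected {x | 0 < s * height p x} := by
  have : {x | 0 < s * height p x} = chart p '' {x : Plane | 0 < s * x 1} := by
    rw [Homeomorph.image_eq_preimage_symm]; rfl
  rw [this]
  exact (convex_halfPlane s).isPreconnected.image _ (chart p).continuous.continuousOn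

lemma isOpen_side (p : Set Plane) (s : ℝ) : IsOpen {x | 0 < s * height p x} :=
  isOpen_lt continuous_const (continuous_const.mul (continuous_height p))

/-- Every point of a pseudoline has small neighbourhoods whose two halves are connected. -/
lemma IsPseudoline.exists_nhds {p : Set Plane} (hp : IsPseudoline p) {x : Plane} (hx : x ∈ p)
    {U : Set Plane} (hU : U ∈ 𝓝 x) :
    ∃ V ⊆ U, V ∈ 𝓝 x ∧ ∀ s : ℝ, s ≠ 0 → IsConnected (V ∩ {y | 0 < s * height p y}) := by
  have h1 : (chart p) ⁻¹' U ∈ 𝓝 ((chart p).symm x) :=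
    (chart p).continuous.continuousAt.preimage_mem_nhds (by simpa using hU)
  obtain ⟨r, hr, hb⟩ := Metric.mem_nhds_iff.1 h1
  refine ⟨(chart p).symm ⁻¹' Metric.ball ((chart p).symm x) r, ?_, ?_, fun s hs => ?_⟩
  · intro y hy
    simpa using hb hy
  · exact (chart p).symm.continuous.continuousAt.preimage_mem_nhds (Metric.ball_mem_nhds _ hr)
  · have : (chart p).symm ⁻¹' Metric.ball ((chart p).symm x) r ∩ {y | 0 < s * height p y} =
        chart p '' (Metric.ball ((chart p).symm x) r ∩ {x : Plane | 0 < s * x 1}) := by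
      rw [Homeomorph.image_eq_preimage_symm]; rfl
    rw [this]
    refine IsConnected.image ⟨?_, ((convex_ball _ _).inter (convex_halfPlane s)).isPreconnected⟩ _
      (chart p).continuous.continuousOn
    rw [hp.mem_iff] at hx
    unfold height at hx
    set c := (chart p).symm x
    -- The centre of the ball, moved by half the radius to the side given by the sign of `s`.
    refine ⟨c + EuclideanSpace.single 1 (r / 2 * SignType.sign s), ?_, ?_⟩
    · rw [mem_ball_iff_norm, add_sub_cancel_left, PiLp.norm_single, Real.norm_eq_abs,
        abs_mul, abs_of_pos (half_pos hr)]
      rcases hs.lt_or_gt with h | h <;> simp [h] <;> linarith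
    · simp only [mem_ofPred_eq, PiLp.add_apply, hx, zero_add, PiLp.single_apply, if_true]
      have : s * (r / 2 * (SignType.sign s : ℝ)) = |s| * (r / 2) := by
        rw [← sign_mul_self s]; ring
      rw [this]; positivity

/-! ### Two crossing pseudolines -/

lemma mul_pos_of_ne_zero_on {X : Type*} [TopologicalSpace X] {φ : X → ℝ} (hφ : Continuous φ)
    {s : Set X} (hs : IsPreconnected s)
    (h0 : ∀ t ∈ s, φ t ≠ 0) {a b : X} (ha : a ∈ s) (hb : b ∈ s) : 0 < φ a * φ b := by
  by_contra! h
  have key : ∀ a ∈ s, ∀ b ∈ s, φ a < 0 → 0 < φ b → False := fun a ha b hb h1 h2 => by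
    obtain ⟨t, ht, h⟩ := hs.intermediate_value ha hb hφ.continuousOn ⟨h1.le, h2.le⟩
    exact h0 t ht h
  rcases (h0 a ha).lt_or_gt with h1 | h1 <;> rcases (h0 b hb).lt_or_gt with h2 | h2
  · exact absurd (mul_pos_of_neg_of_neg h1 h2) h.not_gt
  · exact key a ha b hb h1 h2
  · exact key b hb a ha h2 h1
  · exact absurd (mul_pos h1 h2) h.not_gt

/-- A continuous function with just one zero that takes values of both signs changes sign there. -/
lemma exists_sign_change {φ : ℝ → ℝ} (hφ : Continuous φ) {t₀ : ℝ} (h0 : ∀ t, t ≠ t₀ → φ t ≠ 0)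
    {a b : ℝ} (hab : φ a * φ b < 0) (h00 : φ t₀ = 0) :
    ∃ ε : ℝ, ε ≠ 0 ∧ ∀ t, t ≠ t₀ → 0 < ε * (t - t₀) * φ t := by
  have hr : ∀ s t, t₀ < s → t₀ < t → 0 < φ s * φ t := fun s t hs ht =>
    mul_pos_of_ne_zero_on hφ (s := Ioi t₀) isPreconnected_Ioi (fun u hu => h0 u (ne_of_gt hu)) hs ht
  have hl : ∀ s t, s < t₀ → t < t₀ → 0 < φ s * φ t := fun s t hs ht =>
    mul_pos_of_ne_zero_on hφ (s := Iio t₀) isPreconnected_Iio (fun u hu => h0 u (ne_of_lt hu)) hs ht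
  have key : ∀ a b, φ a * φ b < 0 → a < t₀ → t₀ < b →
      ∃ ε : ℝ, ε ≠ 0 ∧ ∀ t, t ≠ t₀ → 0 < ε * (t - t₀) * φ t := by
    intro a b hab ha hb
    -- Only the sign of `ε` matters: it is the sign of `φ` to the right of `t₀`.
    refine ⟨φ b, h0 b hb.ne', fun t ht => ?_⟩
    rcases ht.lt_or_gt with h | h
    · have h1 := hl t a h ha
      have h2 : φ b * φ t < 0 := by
        have h3 : 0 < φ a * φ a := mul_self_pos.2 (h0 a ha.ne)
        by_contra! h4
        nlinarith [mul_nonneg h4 h3.le, mul_pos h1 (neg_pos.2 hab)]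
      nlinarith
    · have h1 := hr b t hb h
      nlinarith
  have ha : a ≠ t₀ := by rintro rfl; simp [h00] at hab
  have hb : b ≠ t₀ := by rintro rfl; simp [h00] at hab
  rcases ha.lt_or_gt with h1 | h1 <;> rcases hb.lt_or_gt with h2 | h2
  · exact absurd (hl a b h1 h2) hab.not_gt
  · exact key a b hab h1 h2
  · exact key b a (by rwa [mul_comm]) h2 h1
  · exact absurd (hr a b h1 h2) hab.not_gt

variable {L M N : Set (Set Plane)} {p q r w : Set Plane} {v x y z z' : Plane}

lemma IsArrangement.mono (hL : IsArrangement L) (h : M ⊆ L) : IsArrangement M :=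
  ⟨hL.finite.subset h, fun p hp => hL.pseudoline p (h hp), Set.Pairwise.mono h hL.cross⟩

lemma IsSimpleArrangement.mono (hL : IsSimpleArrangement L) (h : M ⊆ L) :
    IsSimpleArrangement M :=
  ⟨hL.toIsArrangement.mono h, fun x => (encard_le_encard fun _ (hp : _ ∧ _) =>
    (⟨h hp.1, hp.2⟩ : _ ∧ _)).trans (hL.simple x)⟩

lemma IsSimpleArrangement.not_mem_three (hL : IsSimpleArrangement L) (hp : p ∈ L) (hq : q ∈ L)
    (hr : r ∈ L) (hpq : p ≠ q) (hpr : p ≠ r) (hqr : q ≠ r) (xp : x ∈ p) (xq : x ∈ q) :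
    x ∉ r := by
  intro xr
  have h : ({p, q, r} : Set (Set Plane)) ⊆ {p ∈ L | x ∈ p} := by
    rintro _ (rfl | rfl | rfl) <;> exact ⟨‹_›, ‹_›⟩
  have h3 : ({p, q, r} : Set (Set Plane)).encard = 3 := encard_eq_three.2 ⟨p, q, r, hpq, hpr, hqr, rfl⟩
  have := (encard_le_encard h).trans (hL.simple x)
  rw [h3] at this
  exact absurd this (by decide)

/-- Along `q`, the height over `p` changes its sign exactly at the crossing. -/
lemma IsArrangement.exists_height_param (hL : IsArrangement L) (hp : p ∈ L) (hq : q ∈ L)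
    (hpq : p ≠ q) : ∃ t₀ ε : ℝ, ε ≠ 0 ∧ height p (param q t₀) = 0 ∧
      ∀ t, t ≠ t₀ → 0 < ε * (t - t₀) * height p (param q t) := by
  obtain ⟨⟨v, hv⟩, a, ha, b, hb, hap, hbp, hab⟩ := hL.cross hp hq hpq
  have hP := hL.pseudoline p hp
  have hQ := hL.pseudoline q hq
  have hvm : v ∈ p ∩ q := hv ▸ mem_singleton v
  have h00 : height p (param q (coord q v)) = 0 := by
    rw [hQ.param_coord hvm.2]; exact hP.mem_iff.1 hvm.1
  have hne : ∀ t, t ≠ coord q v → height p (param q t) ≠ 0 := by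
    intro t ht h
    have : param q t ∈ p ∩ q := ⟨hP.mem_iff.2 h, hQ.param_mem t⟩
    rw [hv, mem_singleton_iff] at this
    rw [← this, coord_param] at ht
    exact ht rfl
  have hneg : height p (param q (coord q a)) * height p (param q (coord q b)) < 0 := by
    simp only [hQ.param_coord ha, hQ.param_coord hb]
    rw [hP.mem_iff] at hap hbp
    by_contra! h
    have h : 0 < height p a * height p b := lt_of_le_of_ne h (mul_ne_zero hap hbp).symm
    refine hab ((isPreconnected_side p (height p a)).subset_connectedComponentIn
      (mul_self_pos.2 hap) ?_ h)
    intro y hy hyp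
    rw [mem_ofPred_eq, hP.mem_iff.1 hyp, mul_zero] at hy
    exact hy.false
  obtain ⟨ε, h1, h2⟩ := exists_sign_change (φ := fun t => height p (param q t))
    ((continuous_height p).comp (continuous_param q)) hne hneg h00
  exact ⟨coord q v, ε, h1, h00, h2⟩

/-- Close to a crossing with `p`, the pseudoline `q` has points on both sides of `p`. -/
lemma IsArrangement.exists_near_crossing (hL : IsArrangement L) (hp : p ∈ L) (hq : q ∈ L)
    (hpq : p ≠ q) (xp : x ∈ p) (xq : x ∈ q) {U : Set Plane} (hU : U ∈ 𝓝 x) {s : ℝ} (hs : s ≠ 0) :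
    ∃ y ∈ U, y ∈ q ∧ 0 < height p y * s := by
  obtain ⟨t₀, ε, hε, h0, h⟩ := hL.exists_height_param hp hq hpq
  have hP := hL.pseudoline p hp
  have hQ := hL.pseudoline q hq
  have hx : param q t₀ = x := by
    rw [← hQ.param_coord xq]
    by_contra hne
    have := h (coord q x) (fun h => hne (by rw [h]))
    rw [hQ.param_coord xq, hP.mem_iff.1 xp, mul_zero] at this
    exact this.false
  have hV : param q ⁻¹' U ∈ 𝓝 t₀ :=
    (continuous_param q).continuousAt.preimage_mem_nhds (by rwa [hx])
  obtain ⟨δ, hδ, hb⟩ := Metric.mem_nhds_iff.1 hV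
  have key : ∀ t, |t - t₀| < δ → 0 < ε * (t - t₀) * s → ∃ y ∈ U, y ∈ q ∧ 0 < height p y * s := by
    intro t ht hts
    refine ⟨param q t, hb (by rwa [Metric.mem_ball, Real.dist_eq]), hQ.param_mem t, ?_⟩
    have h1 := h t (by rintro rfl; simp at hts)
    by_contra! h2
    have : 0 < (ε * (t - t₀) * height p (param q t)) * (ε * (t - t₀) * s) := mul_pos h1 hts
    have h3 : (ε * (t - t₀) * height p (param q t)) * (ε * (t - t₀) * s) =
      (ε * (t - t₀)) ^ 2 * (height p (param q t) * s) := by ring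
    rw [h3] at this
    exact absurd (mul_nonpos_of_nonneg_of_nonpos (sq_nonneg _) h2) this.not_ge
  rcases (mul_ne_zero hε hs).lt_or_gt with h1 | h1
  · refine key (t₀ - δ / 2) ?_ ?_
    · rw [sub_sub_cancel_left, abs_neg, abs_of_pos (half_pos hδ)]; linarith
    · nlinarith [half_pos hδ]
  · refine key (t₀ + δ / 2) ?_ ?_
    · rw [add_sub_cancel_left, abs_of_pos (half_pos hδ)]; linarith
    · nlinarith [half_pos hδ]

/-! ### Regions and arcs -/

/-- The points that lie on the same side as `z` of every pseudoline of `N`. -/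
def region (N : Set (Set Plane)) (z : Plane) : Set Plane :=
  {x | ∀ r ∈ N, 0 < height r x * height r z}

/-- The part of `p` that lies on the same side as `z` of every other pseudoline of `M`. -/
def arc (M : Set (Set Plane)) (z : Plane) (p : Set Plane) : Set Plane :=
  p ∩ region (M \ {p}) z

/-- The pseudolines of `M` that carry an edge of the cell of `z`. -/
def sides (M : Set (Set Plane)) (z : Plane) : Set (Set Plane) :=
  {p ∈ M | (arc M z p).Nonempty}

/-- "Same side" is expressed throughout by a positive product of heights; this is its transitivity.
-/
lemma mul_pos_trans {a b c : ℝ} (h1 : 0 < a * b) (h2 : 0 < b * c) : 0 < a * c := by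
  have : 0 < (a * c) * (b * b) := by nlinarith [mul_pos h1 h2]
  exact pos_of_mul_pos_left this (mul_self_nonneg b)

lemma region_mono (h : M ⊆ N) (z : Plane) : region N z ⊆ region M z :=
  fun _ hx r hr => hx r (h hr)

lemma region_eq (h : y ∈ region N z) : region N y = region N z := by
  ext x
  refine forall₂_congr fun r hr => ⟨fun h1 => mul_pos_trans h1 (h r hr), fun h1 => ?_⟩
  exact mul_pos_trans h1 (by rw [mul_comm]; exact h r hr)

lemma self_mem_region (h : ∀ r ∈ N, height r z ≠ 0) : z ∈ region N z :=
  fun r hr => mul_self_pos.2 (h r hr)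

lemma height_ne_zero_of_mem_region (h : y ∈ region N z) : ∀ r ∈ N, height r y ≠ 0 :=
  fun r hr => left_ne_zero_of_mul (h r hr).ne'

lemma region_insert (M : Set (Set Plane)) (p : Set Plane) (z : Plane) :
    region (insert p M) z = region M z ∩ {x | 0 < height p x * height p z} := by
  ext x; simp [region, and_comm]

lemma isOpen_region (hN : N.Finite) (z : Plane) : IsOpen (region N z) := by
  have : region N z = ⋂ r ∈ N, {x | 0 < height r x * height r z} := by ext; simp [region]
  rw [this]
  exact hN.isOpen_biInter fun r _ =>
    isOpen_lt continuous_const ((continuous_height r).mul continuous_const)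

lemma height_mul_nonneg_of_mem_closure {s : Set Plane} {c : ℝ} (h : ∀ y ∈ s, 0 < height p y * c)
    (hx : x ∈ closure s) : 0 ≤ height p x * c := by
  have hc : IsClosed {y | 0 ≤ height p y * c} :=
    isClosed_le continuous_const ((continuous_height p).mul continuous_const)
  exact closure_minimal (fun y hy => (h y hy).le) hc hx

/-- Along `p` each height changes sign only once, so each sign condition cuts out an open half-line
of parameters. -/
lemma IsArrangement.ordConnected_region (hL : IsArrangement L) (hp : p ∈ L) (hN : N ⊆ L)
    (hpN : p ∉ N) (z : Plane) : OrdConnected (param p ⁻¹' region N z) := by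
  refine ⟨fun a ha b hb t ht r hr => ?_⟩
  obtain ⟨t₀, ε, hε, h0, h⟩ := hL.exists_height_param (hN hr) hp (by rintro rfl; exact hpN hr)
  have h1 := ha r hr
  have h2 := hb r hr
  have key : ∀ t, 0 < height r (param p t) * height r z ↔ 0 < ε * (t - t₀) * height r z := by
    intro t
    rcases eq_or_ne t t₀ with rfl | ht
    · simp [h0]
    · have := h t ht
      exact ⟨fun h => mul_pos_trans this h, fun h => mul_pos_trans (by rwa [mul_comm]) h⟩
  rw [key] at h1 h2 ⊢
  have h3 : ε * (t - t₀) * height r z = (ε * height r z) * (t - t₀) := by ring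
  have h4 : ε * (a - t₀) * height r z = (ε * height r z) * (a - t₀) := by ring
  have h5 : ε * (b - t₀) * height r z = (ε * height r z) * (b - t₀) := by ring
  rw [h3]
  rw [h4] at h1
  rw [h5] at h2
  rcases le_total 0 (ε * height r z) with h6 | h6
  · exact h1.trans_le (mul_le_mul_of_nonneg_left (by linarith [ht.1]) h6)
  · exact h2.trans_le (mul_le_mul_of_nonpos_left (by linarith [ht.2]) h6)

lemma IsPseudoline.inter_eq_image (hp : IsPseudoline p) (s : Set Plane) :
    p ∩ s = param p '' (param p ⁻¹' s) := by
  rw [image_preimage_eq_inter_range, inter_comm]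
  congr 1
  ext x
  exact ⟨fun hx => ⟨_, hp.param_coord hx⟩, by rintro ⟨t, rfl⟩; exact hp.param_mem t⟩

lemma IsArrangement.isPreconnected_inter_region (hL : IsArrangement L) (hp : p ∈ L) (hN : N ⊆ L)
    (hpN : p ∉ N) (z : Plane) : IsPreconnected (p ∩ region N z) := by
  rw [(hL.pseudoline p hp).inter_eq_image]
  exact (hL.ordConnected_region hp hN hpN z).isPreconnected.image _
    (continuous_param p).continuousOn

/-! ### Cells are regions, edges are arcs -/

/-- A pseudoline that meets a connected open set in a connected set cuts it into connected
parts. -/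
lemma IsPseudoline.isPreconnected_inter_side (hp : IsPseudoline p) {C : Set Plane}
    (hCo : IsOpen C) (hC : IsPreconnected C) (hpC : IsPreconnected (p ∩ C)) {s : ℝ} (hs : s ≠ 0) :
    IsPreconnected (C ∩ {y | 0 < s * height p y}) := by
  set H := C ∩ {y | 0 < s * height p y} with hH
  rw [isPreconnected_iff_subset_of_disjoint]
  -- If `H` lies in `u` near `p ∩ C`, then `C` is covered by two disjoint open sets: the points near
  -- which `H` lies in `u`, and `v ∩ H`. Connectedness of `C` decides between them.
  have main : ∀ u v : Set Plane, IsOpen u → IsOpen v → H ⊆ u ∪ v → H ∩ (u ∩ v) = ∅ →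
      p ∩ C ⊆ {x | ∀ᶠ y in 𝓝 x, y ∈ H → y ∈ u} → H ⊆ u ∨ H ⊆ v := by
    intro u v hu hv huv hd hpu
    have hHo : IsOpen H := hCo.inter (isOpen_side p s)
    have h := isPreconnected_iff_subset_of_disjoint.1 hC {x | ∀ᶠ y in 𝓝 x, y ∈ H → y ∈ u} (v ∩ H)
      isOpen_setOfPred_eventually_nhds (hv.inter hHo) ?_ ?_
    · rcases h with h | h
      · exact Or.inl fun x hx => (h hx.1).self_of_nhds hx
      · exact Or.inr fun x hx => (h hx.1).1
    · intro x hx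
      by_cases hxp : x ∈ p
      · exact Or.inl (hpu ⟨hxp, hx⟩)
      · rw [hp.mem_iff] at hxp
        rcases (mul_ne_zero hs hxp).lt_or_gt with h1 | h1
        · left
          have : {y | s * height p y < 0} ∈ 𝓝 x :=
            (isOpen_lt (continuous_const.mul (continuous_height p)) continuous_const).mem_nhds h1
          filter_upwards [this] with y hy hyH
          exact absurd hyH.2 (not_lt_of_ge (le_of_lt hy))
        · have hxH : x ∈ H := ⟨hx, h1⟩
          rcases huv hxH with h2 | h2
          · left
            filter_upwards [hu.mem_nhds h2] with y hy _ using hy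
          · exact Or.inr ⟨h2, hxH⟩
    · rw [eq_empty_iff_forall_notMem]
      rintro x ⟨-, h1, h2, h3⟩
      have : x ∈ H ∩ (u ∩ v) := ⟨h3, (h1 : ∀ᶠ y in 𝓝 x, y ∈ H → y ∈ u).self_of_nhds h3, h2⟩
      rw [hd] at this
      exact this
  intro u v hu hv huv hd
  -- Near a point of `p ∩ C` the set `H` contains a connected half-neighbourhood, which lies in `u`
  -- or in `v`. The choice is locally constant, hence constant on `p ∩ C`.
  have h := isPreconnected_iff_subset_of_disjoint.1 hpC {x | ∀ᶠ y in 𝓝 x, y ∈ H → y ∈ u}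
    {x | ∀ᶠ y in 𝓝 x, y ∈ H → y ∈ v} isOpen_setOfPred_eventually_nhds isOpen_setOfPred_eventually_nhds ?_ ?_
  · rcases h with h | h
    · exact main u v hu hv huv hd h
    · exact (main v u hv hu (by rwa [union_comm]) (by rwa [inter_comm v u]) h).symm
  · rintro x ⟨hxp, hxC⟩
    obtain ⟨V, hVC, hVx, hV⟩ := hp.exists_nhds hxp (hCo.mem_nhds hxC)
    have hsub : V ∩ {y | 0 < s * height p y} ⊆ H := inter_subset_inter_left _ hVC
    rcases isPreconnected_iff_subset_of_disjoint.1 (hV s hs).isPreconnected u v hu hv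
      (hsub.trans huv) (subset_empty_iff.1 (hd ▸ inter_subset_inter_left _ hsub)) with h1 | h1
    · left
      filter_upwards [hVx] with y hy hyH using h1 ⟨hy, hyH.2⟩
    · right
      filter_upwards [hVx] with y hy hyH using h1 ⟨hy, hyH.2⟩
  · rw [eq_empty_iff_forall_notMem]
    rintro x ⟨⟨hxp, hxC⟩, h1, h2⟩
    obtain ⟨V, hVU, hVx, hV⟩ := hp.exists_nhds hxp
      (Filter.inter_mem (Filter.inter_mem (hCo.mem_nhds hxC) h1) h2)
    obtain ⟨y, hyV, hys⟩ := (hV s hs).nonempty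
    have hyH : y ∈ H := ⟨(hVU hyV).1.1, hys⟩
    have : y ∈ H ∩ (u ∩ v) := ⟨hyH, (hVU hyV).1.2 hyH, (hVU hyV).2 hyH⟩
    rw [hd] at this
    exact this

/-- Add the pseudolines one at a time: each meets the current region in an interval, so the half
that contains `z` stays connected. -/
lemma IsArrangement.isPreconnected_region (hL : IsArrangement L) (hz : ∀ r ∈ L, height r z ≠ 0) :
    IsPreconnected (region L z) := by
  have key : ∀ N : Set (Set Plane), N.Finite → N ⊆ L → IsPreconnected (region N z) := by
    intro N hN
    induction N, hN using Set.Finite.induction_on with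
    | empty =>
      intro _
      have : region ∅ z = univ := by ext; simp [region]
      rw [this]; exact isPreconnected_univ
    | @insert p N hpN hN ih =>
      intro h
      have hpL := h (mem_insert p N)
      have hNL := (subset_insert p N).trans h
      rw [region_insert]
      simp only [mul_comm _ (height p z)]
      exact (hL.pseudoline p hpL).isPreconnected_inter_side (isOpen_region hN z) (ih hNL)
        (hL.isPreconnected_inter_region hpL hNL hpN z) (hz p hpL)
  exact key L hL.finite Subset.rfl

lemma IsArrangement.notMem_sUnion_iff (hL : IsArrangement L) (hN : N ⊆ L) :
    x ∉ ⋃₀ N ↔ ∀ r ∈ N, height r x ≠ 0 := by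
  simp only [mem_sUnion, not_exists, not_and]
  exact forall₂_congr fun r hr => by rw [(hL.pseudoline r (hN hr)).mem_iff]

lemma subset_region_of_isPreconnected {s : Set Plane} (hs : IsPreconnected s)
    (h : ∀ x ∈ s, ∀ r ∈ N, height r x ≠ 0) (hx : x ∈ s) : s ⊆ region N x :=
  fun _ hy r hr =>
    mul_pos_of_ne_zero_on (continuous_height r) hs (fun t ht => h t ht r hr) hy hx

lemma IsArrangement.connectedComponentIn_eq_region (hL : IsArrangement L)
    (hz : ∀ r ∈ L, height r z ≠ 0) : connectedComponentIn (⋃₀ L)ᶜ z = region L z := by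
  refine Subset.antisymm ?_ ?_
  · refine subset_region_of_isPreconnected isPreconnected_connectedComponentIn (fun x hx => ?_)
      (mem_connectedComponentIn ((hL.notMem_sUnion_iff Subset.rfl).2 hz))
    exact (hL.notMem_sUnion_iff Subset.rfl).1 (connectedComponentIn_subset _ _ hx)
  · refine (hL.isPreconnected_region hz).subset_connectedComponentIn (self_mem_region hz) ?_
    exact fun x hx => (hL.notMem_sUnion_iff Subset.rfl).2 (height_ne_zero_of_mem_region hx)

lemma IsArrangement.connectedComponentIn_eq_arc (hL : IsArrangement L) (hp : p ∈ L) (hx : x ∈ p)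
    (hz : ∀ r ∈ L \ {p}, height r x ≠ 0) :
    connectedComponentIn (p \ ⋃₀ (L \ {p})) x = arc L x p := by
  refine Subset.antisymm (subset_inter ?_ ?_) ?_
  · exact (connectedComponentIn_subset _ _).trans sdiff_subset
  · refine subset_region_of_isPreconnected isPreconnected_connectedComponentIn (fun y hy => ?_)
      (mem_connectedComponentIn ⟨hx, (hL.notMem_sUnion_iff sdiff_subset).2 hz⟩)
    exact (hL.notMem_sUnion_iff sdiff_subset).1 (connectedComponentIn_subset _ _ hy).2
  · refine IsPreconnected.subset_connectedComponentIn ?_ ⟨hx, self_mem_region hz⟩ ?_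
    · exact hL.isPreconnected_inter_region (N := L \ {p}) hp sdiff_subset (fun h => h.2 rfl) x
    · exact fun y hy => ⟨hy.1, (hL.notMem_sUnion_iff sdiff_subset).2
        (height_ne_zero_of_mem_region hy.2)⟩

/-- The region of `z` has points close to every point of its arcs. -/
lemma IsArrangement.arc_subset_closure (hL : IsArrangement L) (hp : p ∈ L)
    (hz : height p z ≠ 0) : arc L z p ⊆ closure (region L z) := by
  rintro x ⟨hxp, hx⟩
  rw [mem_closure_iff_nhds]
  intro U hU
  have ho : IsOpen (region (L \ {p}) z) := isOpen_region (hL.finite.subset sdiff_subset) z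
  obtain ⟨V, hVU, hVx, hV⟩ := (hL.pseudoline p hp).exists_nhds hxp
    (Filter.inter_mem hU (ho.mem_nhds hx))
  obtain ⟨y, hyV, hy⟩ := (hV _ hz).nonempty
  refine ⟨y, (hVU hyV).1, fun r hr => ?_⟩
  by_cases h : r = p
  · subst h; rw [mul_comm]; exact hy
  · exact (hVU hyV).2 r ⟨hr, h⟩

lemma notMem_region (hL : IsArrangement L) (hp : p ∈ L) (hx : x ∈ p) : x ∉ region L z := by
  intro h
  have := h p hp
  rw [(hL.pseudoline p hp).mem_iff.1 hx, zero_mul] at this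
  exact this.false

/-- Sign conditions become weak inequalities on the closure, and are strict again where no height
vanishes. -/
lemma mem_region_of_mem_closure (hx : x ∈ closure (region M z)) (hN : N ⊆ M)
    (h : ∀ r ∈ N, height r x ≠ 0) (hz : ∀ r ∈ N, height r z ≠ 0) : x ∈ region N z := by
  intro r hr
  refine lt_of_le_of_ne ?_ (mul_ne_zero (h r hr) (hz r hr)).symm
  exact height_mul_nonneg_of_mem_closure (s := region M z) (fun y hy => hy r (hN hr)) hx

lemma arc_eq (h : y ∈ region (M \ {p}) z) : arc M y p = arc M z p := by
  unfold arc; rw [region_eq h]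

lemma IsArrangement.edgesOf_region (hL : IsArrangement L) (hz : ∀ r ∈ L, height r z ≠ 0) :
    edgesOf L (region L z) = arc L z '' sides L z := by
  have ho := isOpen_region hL.finite z
  ext e
  constructor
  · rintro ⟨⟨p, hp, x, ⟨hxp, hx⟩, rfl⟩, he⟩
    rw [hL.notMem_sUnion_iff sdiff_subset] at hx
    rw [hL.connectedComponentIn_eq_arc hp hxp hx] at he ⊢
    have hxe : x ∈ arc L x p := ⟨hxp, self_mem_region hx⟩
    have h1 : x ∈ region (L \ {p}) z := mem_region_of_mem_closure (frontier_subset_closure (he hxe))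
      sdiff_subset hx (fun r hr => hz r hr.1)
    rw [arc_eq h1]
    exact ⟨p, ⟨hp, x, hxp, h1⟩, rfl⟩
  · rintro ⟨p, ⟨hp, x, hxp, hx⟩, rfl⟩
    have hx' := height_ne_zero_of_mem_region hx
    refine ⟨⟨p, hp, x, ⟨hxp, (hL.notMem_sUnion_iff sdiff_subset).2 hx'⟩, ?_⟩, ?_⟩
    · rw [hL.connectedComponentIn_eq_arc hp hxp hx', arc_eq hx]
    · rw [ho.frontier_eq]
      exact fun y hy => ⟨hL.arc_subset_closure hp (hz p hp) hy, notMem_region hL hp hy.1⟩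

lemma IsArrangement.notMem_arc (hL : IsArrangement L) (hp : p ∈ L) (hpq : p ≠ q) (hx : x ∈ p) :
    x ∉ arc L z q := by
  intro h
  exact height_ne_zero_of_mem_region h.2 p ⟨hp, hpq⟩ ((hL.pseudoline p hp).mem_iff.1 hx)

/-- Arcs on different pseudolines are disjoint, so edges can be counted by the pseudolines that
carry them. -/
lemma IsArrangement.encard_edgesOf (hL : IsArrangement L) (hz : ∀ r ∈ L, height r z ≠ 0) :
    (edgesOf L (region L z)).encard = (sides L z).encard := by
  rw [hL.edgesOf_region hz]
  refine InjOn.encard_image fun p hp q hq h => ?_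
  by_contra hpq
  obtain ⟨x, hx⟩ := hp.2
  exact hL.notMem_arc hp.1 hpq hx.1 (h ▸ hx)

lemma IsArrangement.isGeFiveGon_region (hL : IsArrangement L) (hz : ∀ r ∈ L, height r z ≠ 0) :
    IsGeFiveGon L (region L z) ↔
      Bornology.IsBounded (region L z) ∧ 5 ≤ (sides L z).encard := by
  have hfin : (sides L z).Finite := hL.finite.subset fun _ h => h.1
  constructor
  · rintro ⟨n, hn, ⟨-, hb⟩, h⟩
    rw [hL.encard_edgesOf hz] at h
    exact ⟨hb, h ▸ by exact_mod_cast hn⟩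
  · rintro ⟨hb, h⟩
    refine ⟨(sides L z).ncard, ?_, ⟨⟨z, (hL.notMem_sUnion_iff Subset.rfl).2 hz, ?_⟩, hb⟩, ?_⟩
    · rw [← hfin.cast_ncard_eq] at h; exact_mod_cast h
    · rw [hL.connectedComponentIn_eq_region hz]
    · rw [hL.encard_edgesOf hz, hfin.cast_ncard_eq]

/-! ### Cutting a cell by one more pseudoline -/

lemma IsArrangement.isOpen_region_sdiff (hL : IsArrangement L) (hM : M ⊆ L) (N : Set (Set Plane))
    (z : Plane) : IsOpen (region (M \ N) z) :=
  isOpen_region (hL.finite.subset (sdiff_subset.trans hM)) z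

lemma region_insert_eq (hz' : z' ∈ region M z) :
    region (insert p M) z' = region M z ∩ {x | 0 < height p x * height p z'} := by
  rw [region_insert, region_eq hz']

lemma region_insert_subset (hz' : z' ∈ region M z) : region (insert p M) z' ⊆ region M z := by
  rw [region_insert_eq hz']; exact inter_subset_left

lemma arc_insert_eq (hz' : z' ∈ region M z) (hrp : r ≠ p) :
    arc (insert p M) z' r = arc M z r ∩ {x | 0 < height p x * height p z'} := by
  have : insert p M \ {r} = insert p (M \ {r}) := insert_sdiff_of_notMem _ (by simpa using hrp.symm)
  rw [arc, this, region_insert_eq (region_mono sdiff_subset z hz'), ← inter_assoc, arc]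

lemma arc_insert_self (hz' : z' ∈ region M z) (hpM : p ∉ M) :
    arc (insert p M) z' p = p ∩ region M z := by
  rw [arc, insert_sdiff_self_of_notMem hpM, region_eq hz']

/-- A pseudoline that crosses an edge of a cell enters the cell there. -/
lemma IsArrangement.mem_closure_of_mem_arc (hL : IsArrangement L) (hM : M ⊆ L)
    (hz : ∀ r ∈ M, height r z ≠ 0) (hp : p ∈ L) (hpM : p ∉ M) (hr : r ∈ M) (xp : x ∈ p)
    (xr : x ∈ arc M z r) : x ∈ closure (p ∩ region M z) := by
  rw [mem_closure_iff_nhds]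
  intro U hU
  obtain ⟨y, hyU, hyp, hy⟩ := hL.exists_near_crossing (hM hr) hp (by rintro rfl; exact hpM hr)
    xr.1 xp (Filter.inter_mem hU ((hL.isOpen_region_sdiff hM {r} z).mem_nhds xr.2)) (hz r hr)
  refine ⟨y, hyU.1, hyp, fun r' hr' => ?_⟩
  by_cases h : r' = r
  · rwa [h]
  · exact hyU.2 r' ⟨hr', h⟩

/-- A pseudoline cuts the edges that it meets into two nonempty parts. -/
lemma IsArrangement.mem_closure_arc_inter (hL : IsArrangement L) (hM : M ⊆ L)
    (hp : p ∈ L) (hpM : p ∉ M) (hr : r ∈ M) (xp : x ∈ p) (xr : x ∈ arc M z r) {s : ℝ}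
    (hs : s ≠ 0) : x ∈ closure (arc M z r ∩ {y | 0 < height p y * s}) := by
  rw [mem_closure_iff_nhds]
  intro U hU
  obtain ⟨y, hyU, hyr, hy⟩ := hL.exists_near_crossing hp (hM hr) (by rintro rfl; exact hpM hr)
    xp xr.1 (Filter.inter_mem hU ((hL.isOpen_region_sdiff hM {r} z).mem_nhds xr.2)) hs
  exact ⟨y, hyU.1, ⟨hyr, hyU.2⟩, hy⟩

/-- A pseudoline that meets a cell has points of the cell on both sides. -/
lemma IsArrangement.exists_mem_region_side (hL : IsArrangement L) (hM : M ⊆ L) (hp : p ∈ L)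
    (xp : x ∈ p) (hx : x ∈ region M z) {s : ℝ} (hs : s ≠ 0) :
    ∃ y ∈ region M z, 0 < height p y * s := by
  obtain ⟨V, hV, -, h⟩ := (hL.pseudoline p hp).exists_nhds xp
    ((isOpen_region (hL.finite.subset hM) z).mem_nhds hx)
  obtain ⟨y, hyV, hy⟩ := (h s hs).nonempty
  exact ⟨y, hV hyV, by rw [mul_comm]; exact hy⟩

lemma IsArrangement.mem_sides_insert (hL : IsArrangement L) (hM : M ⊆ L)
    (hp : p ∈ L) (hpM : p ∉ M) (hr : r ∈ M) (xp : x ∈ p) (xr : x ∈ arc M z r)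
    (hz' : z' ∈ region M z) (hp' : height p z' ≠ 0) : r ∈ sides (insert p M) z' := by
  refine ⟨mem_insert_of_mem _ hr, ?_⟩
  rw [arc_insert_eq hz' (by rintro rfl; exact hpM hr)]
  exact closure_nonempty_iff.1 ⟨x, hL.mem_closure_arc_inter hM hp hpM hr xp xr hp'⟩

lemma self_mem_sides_insert (hpM : p ∉ M) (xp : x ∈ p) (hx : x ∈ region M z)
    (hz' : z' ∈ region M z) : p ∈ sides (insert p M) z' :=
  ⟨mem_insert _ _, x, by rw [arc_insert_self hz' hpM]; exact ⟨xp, hx⟩⟩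

/-- Simplicity keeps `p` away from the vertices of `M`, so it leaves a cell through an open edge. -/
lemma IsSimpleArrangement.exists_mem_arc_of_mem_frontier (hL : IsSimpleArrangement L) (hM : M ⊆ L)
    (hz : ∀ r ∈ M, height r z ≠ 0) (hp : p ∈ L) (hpM : p ∉ M) (xp : x ∈ p)
    (hx : x ∈ closure (region M z)) (hx' : x ∉ region M z) : ∃ r ∈ M, x ∈ arc M z r := by
  have h : ∃ r ∈ M, height r x = 0 := by
    by_contra! h
    exact hx' (mem_region_of_mem_closure hx Subset.rfl h hz)
  obtain ⟨r, hr, h⟩ := h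
  have xr : x ∈ r := (hL.pseudoline r (hM hr)).mem_iff.2 h
  refine ⟨r, hr, xr, mem_region_of_mem_closure hx sdiff_subset (fun r' hr' h' => ?_)
    fun r' hr' => hz r' hr'.1⟩
  refine hL.not_mem_three hp (hM hr) (hM hr'.1) ?_ ?_ (Ne.symm hr'.2) xp xr
    ((hL.pseudoline r' (hM hr'.1)).mem_iff.2 h')
  · rintro rfl; exact hpM hr
  · rintro rfl; exact hpM hr'.1

/-- A further pseudoline that meets a bounded cell crosses exactly two of its edges. -/
lemma IsSimpleArrangement.exists_two_crossed_arcs (hL : IsSimpleArrangement L) (hM : M ⊆ L)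
    (hz : ∀ r ∈ M, height r z ≠ 0) (hb : Bornology.IsBounded (region M z)) (hp : p ∈ L)
    (hpM : p ∉ M) (h : (p ∩ region M z).Nonempty) :
    ∃ a ∈ M, ∃ b ∈ M, a ≠ b ∧ (p ∩ arc M z a).Nonempty ∧ (p ∩ arc M z b).Nonempty ∧
      ∀ r ∈ M, (p ∩ arc M z r).Nonempty → r = a ∨ r = b := by
  have hP := hL.pseudoline p hp
  have ho := (isOpen_region (hL.finite.subset hM) z).preimage (continuous_param p)
  have hord := hL.ordConnected_region hp hM hpM z
  set T := param p ⁻¹' region M z with hT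
  have hcoord : ∀ y ∈ p ∩ region M z, coord p y ∈ T := by
    rintro y ⟨hyp, hy⟩
    rw [hT, mem_preimage, hP.param_coord hyp]; exact hy
  obtain ⟨x₀, hx₀⟩ := h
  have hne : T.Nonempty := ⟨_, hcoord x₀ hx₀⟩
  have hTb : Bornology.IsBounded T := by
    refine (hb.isCompact_closure.image (continuous_coord p)).isBounded.subset fun t ht => ?_
    exact ⟨param p t, subset_closure ht, coord_param p t⟩
  have hbb := hTb.bddBelow
  have hba := hTb.bddAbove
  have hinf : sInf T ∉ T := fun hmem => by
    obtain ⟨δ, hδ, hball⟩ := Metric.isOpen_iff.1 ho _ hmem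
    have : sInf T - δ / 2 ∈ T := hball (by
      rw [Metric.mem_ball, Real.dist_eq, sub_sub_cancel_left, abs_neg, abs_of_pos] <;> linarith)
    linarith [csInf_le hbb this]
  have hsup : sSup T ∉ T := fun hmem => by
    obtain ⟨δ, hδ, hball⟩ := Metric.isOpen_iff.1 ho _ hmem
    have : sSup T + δ / 2 ∈ T := hball (by
      rw [Metric.mem_ball, Real.dist_eq, add_sub_cancel_left, abs_of_pos] <;> linarith)
    linarith [le_csSup hba this]
  have hend : ∀ t ∈ closure T, t ∉ T → ∃ r ∈ M, param p t ∈ arc M z r := fun t ht htT =>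
    hL.exists_mem_arc_of_mem_frontier hM hz hp hpM (hP.param_mem t)
      (map_mem_closure (continuous_param p) ht fun _ h => h) htT
  obtain ⟨a, ha, haT⟩ := hend _ (csInf_mem_closure hne hbb) hinf
  obtain ⟨b, hb, hbT⟩ := hend _ (csSup_mem_closure hne hba) hsup
  refine ⟨a, ha, b, hb, ?_, ⟨_, hP.param_mem _, haT⟩, ⟨_, hP.param_mem _, hbT⟩, ?_⟩
  -- If both ends were on one pseudoline, they would be its single crossing with `p`, and the open
  -- interval `T` would collapse.
  · rintro rfl
    have hpa : p ≠ a := by rintro rfl; exact hpM ha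
    obtain ⟨⟨v, hv⟩, -⟩ := hL.cross hp (hM ha) hpa
    have h1 : param p (sInf T) ∈ p ∩ a := ⟨hP.param_mem _, haT.1⟩
    have h2 : param p (sSup T) ∈ p ∩ a := ⟨hP.param_mem _, hbT.1⟩
    rw [hv, mem_singleton_iff] at h1 h2
    have h3 : sInf T = sSup T := by rw [← coord_param p (sInf T), h1, ← h2, coord_param]
    obtain ⟨t, ht⟩ := hne
    have : t = sInf T := le_antisymm (h3 ▸ le_csSup hba ht) (csInf_le hbb ht)
    exact hinf (this ▸ ht)
  · rintro r hr ⟨c, hcp, hcr⟩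
    -- At any crossed edge `p` enters the cell, so the parameter is a limit of `T` outside `T`,
    -- hence an end of the interval.
    have hcT : coord p c ∈ closure T := map_mem_closure (continuous_coord p)
      (hL.mem_closure_of_mem_arc hM hz hp hpM hr hcp hcr) hcoord
    have hcT' : coord p c ∉ T := by
      rw [hT, mem_preimage, hP.param_coord hcp]
      exact notMem_region (hL.toIsArrangement.mono hM) hr hcr.1
    have hIcc : coord p c ∈ Icc (sInf T) (sSup T) :=
      closure_minimal (s := T) (fun t ht => mem_Icc.2 ⟨csInf_le hbb ht, le_csSup hba ht⟩)
        isClosed_Icc hcT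
    have key : coord p c = sInf T ∨ coord p c = sSup T := by
      by_contra! hne'
      obtain ⟨t₁, h1, h1'⟩ := (csInf_lt_iff hbb hne).1 (lt_of_le_of_ne hIcc.1 hne'.1.symm)
      obtain ⟨t₂, h2, h2'⟩ := (lt_csSup_iff hba hne).1 (lt_of_le_of_ne hIcc.2 hne'.2)
      exact hcT' (hord.out h1 h2 ⟨h1'.le, h2'.le⟩)
    have heq : ∀ r' ∈ M, c ∈ r' → r = r' := fun r' hr' hc => by
      by_contra hne'
      exact (hL.toIsArrangement.mono hM).notMem_arc hr' (Ne.symm hne') hc hcr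
    rcases key with h | h
    · left; refine heq a ha ?_; rw [← hP.param_coord hcp, h]; exact haT.1
    · right; refine heq b hb ?_; rw [← hP.param_coord hcp, h]; exact hbT.1

lemma IsSimpleArrangement.exists_other_crossed_arc (hL : IsSimpleArrangement L) (hM : M ⊆ L)
    (hz : ∀ r ∈ M, height r z ≠ 0) (hb : Bornology.IsBounded (region M z)) (hp : p ∈ L)
    (hpM : p ∉ M) (hq : q ∈ M) (h : (p ∩ arc M z q).Nonempty) :
    ∃ b ∈ M, b ≠ q ∧ (p ∩ arc M z b).Nonempty ∧
      ∀ r ∈ M, (p ∩ arc M z r).Nonempty → r = q ∨ r = b := by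
  have hne : (p ∩ region M z).Nonempty := by
    obtain ⟨c, hcp, hc⟩ := h
    exact closure_nonempty_iff.1 ⟨c, hL.mem_closure_of_mem_arc hM hz hp hpM hq hcp hc⟩
  obtain ⟨a, ha, b, hb, hab, hpa, hpb, hall⟩ := hL.exists_two_crossed_arcs hM hz hb hp hpM hne
  rcases hall q hq h with rfl | rfl
  · exact ⟨b, hb, hab.symm, hpb, hall⟩
  · exact ⟨a, ha, hab, hpa, fun r hr hr' => (hall r hr hr').symm⟩

/-- If a further pseudoline misses a cell, it misses its edges, too. -/
lemma IsArrangement.sides_subset_sides_insert (hL : IsArrangement L) (hM : M ⊆ L)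
    (hz : ∀ r ∈ M, height r z ≠ 0) (hp : p ∈ L) (hpM : p ∉ M) (h : p ∩ region M z = ∅)
    (hz' : z' ∈ region M z) : sides M z ⊆ sides (insert p M) z' := by
  have hP := hL.pseudoline p hp
  rintro r ⟨hr, x, hx⟩
  refine ⟨mem_insert_of_mem _ hr, x, ?_⟩
  rw [arc_insert_eq hz' (by rintro rfl; exact hpM hr)]
  have hsub : ∀ y ∈ region M z, 0 < height p y * height p z' := by
    intro y hy
    refine mul_pos_of_ne_zero_on (continuous_height p)
      ((hL.mono hM).isPreconnected_region hz) (fun t ht h0 => ?_) hy hz'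
    have : t ∈ p ∩ region M z := ⟨hP.mem_iff.2 h0, ht⟩
    rw [h] at this
    exact this
  -- Equality would put `x` on `p`, which would then enter the cell at `x`.
  refine ⟨hx, (lt_of_le_of_ne ?_ (mul_ne_zero (fun h0 => ?_) ?_).symm :
    0 < height p x * height p z')⟩
  · exact height_mul_nonneg_of_mem_closure hsub
      ((hL.mono hM).arc_subset_closure hr (hz r hr) hx)
  · have := hL.mem_closure_of_mem_arc hM hz hp hpM hr (hP.mem_iff.2 h0) hx
    rw [h, closure_empty] at this
    exact this
  · exact right_ne_zero_of_mul (hsub z' hz').ne'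

/-! ### Corners of cells -/

/-- The cell of `z` in `M` is bounded and has the vertex `v` between its edges on `w` and `q`, and
the edge on `w` is not crossed by `L`. -/
structure Corner (L M : Set (Set Plane)) (z : Plane) (w q : Set Plane) (v : Plane) : Prop where
  sub : M ⊆ L
  off : ∀ r ∈ M, height r z ≠ 0
  bounded : Bornology.IsBounded (region M z)
  mem_left : w ∈ M
  mem_right : q ∈ M
  ne : w ≠ q
  closure_left : v ∈ closure (arc M z w)
  closure_right : v ∈ closure (arc M z q)
  uncrossed : ∀ r ∈ L, r ≠ w → r ∩ arc M z w = ∅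

lemma Corner.vertex_left (h : Corner L M z w q v) (hL : IsArrangement L) : v ∈ w :=
  closure_minimal inter_subset_left (hL.pseudoline w (h.sub h.mem_left)).isClosed h.closure_left

lemma Corner.vertex_right (h : Corner L M z w q v) (hL : IsArrangement L) : v ∈ q :=
  closure_minimal inter_subset_left (hL.pseudoline q (h.sub h.mem_right)).isClosed h.closure_right

lemma Corner.left_mem_sides (h : Corner L M z w q v) : w ∈ sides M z :=
  ⟨h.mem_left, closure_nonempty_iff.1 ⟨v, h.closure_left⟩⟩

lemma Corner.right_mem_sides (h : Corner L M z w q v) : q ∈ sides M z :=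
  ⟨h.mem_right, closure_nonempty_iff.1 ⟨v, h.closure_right⟩⟩

lemma Corner.height_vertex_ne_zero (h : Corner L M z w q v) (hL : IsSimpleArrangement L)
    (hp : p ∈ L) (hpM : p ∉ M) : height p v ≠ 0 := by
  intro h0
  refine hL.not_mem_three (h.sub h.mem_left) (h.sub h.mem_right) hp h.ne ?_ ?_
    (h.vertex_left hL.toIsArrangement) (h.vertex_right hL.toIsArrangement)
    ((hL.pseudoline p hp).mem_iff.2 h0)
  · rintro rfl; exact hpM h.mem_left
  · rintro rfl; exact hpM h.mem_right

/-- A corner persists on one side of every further pseudoline. -/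
lemma Corner.exists_insert (h : Corner L M z w q v) (hL : IsSimpleArrangement L)
    (hp : p ∈ L) (hpM : p ∉ M) : ∃ z' ∈ region M z, height p z' ≠ 0 ∧
      0 < height p v * height p z' ∧ Corner L (insert p M) z' w q v := by
  have hP := hL.pseudoline p hp
  have hwp : w ≠ p := by rintro rfl; exact hpM h.mem_left
  have hqp : q ≠ p := by rintro rfl; exact hpM h.mem_right
  obtain ⟨y, hy⟩ := h.left_mem_sides.2
  have hne : ∀ x ∈ arc M z w, height p x ≠ 0 := fun x hx h0 => by
    have : x ∈ p ∩ arc M z w := ⟨hP.mem_iff.2 h0, hx⟩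
    rw [h.uncrossed p hp hwp.symm] at this
    exact this
  -- The new base point lies in the cell, close to a point `y` of the uncrossed edge and on the same
  -- side of `p` as `y`.
  obtain ⟨z', hz's, hz'⟩ := mem_closure_iff_nhds.1
    ((hL.toIsArrangement.mono h.sub).arc_subset_closure h.mem_left (h.off w h.mem_left) hy)
    _ ((isOpen_side p (height p y)).mem_nhds (mul_self_pos.2 (hne y hy)))
  have hz's : 0 < height p y * height p z' := hz's
  have hz'0 : height p z' ≠ 0 := right_ne_zero_of_mul hz's.ne'
  have hside : ∀ x ∈ arc M z w, 0 < height p x * height p z' := fun x hx =>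
    mul_pos_trans (mul_pos_of_ne_zero_on (continuous_height p)
      (hL.isPreconnected_inter_region (h.sub h.mem_left) (N := M \ {w}) (sdiff_subset.trans h.sub)
        (fun h => h.2 rfl) z) hne hx hy) hz's
  have hv : 0 < height p v * height p z' :=
    lt_of_le_of_ne (height_mul_nonneg_of_mem_closure hside h.closure_left)
      (mul_ne_zero (h.height_vertex_ne_zero hL hp hpM) hz'0).symm
  have hw' : arc (insert p M) z' w = arc M z w := by
    rw [arc_insert_eq hz' hwp]
    exact inter_eq_left.2 hside
  refine ⟨z', hz', hz'0, hv, insert_subset hp h.sub, ?_, h.bounded.subset (region_insert_subset hz'),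
    mem_insert_of_mem _ h.mem_left, mem_insert_of_mem _ h.mem_right, h.ne, ?_, ?_, ?_⟩
  · rintro r (rfl | hr)
    · exact hz'0
    · exact height_ne_zero_of_mem_region hz' r hr
  · rw [hw']; exact h.closure_left
  · have ho : IsOpen {x | 0 < height p x * height p z'} :=
      isOpen_lt continuous_const ((continuous_height p).mul continuous_const)
    rw [arc_insert_eq hz' hqp]
    exact closure_mono (inter_comm _ _).subset (ho.inter_closure ⟨hv, h.closure_right⟩)
  · rw [hw']; exact h.uncrossed

/-- Among the further pseudolines there is one such that no other one crosses the edge on `q`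
between it and the vertex. -/
lemma Corner.exists_nearest (h : Corner L M z w q v) (hL : IsSimpleArrangement L)
    (hne : (L \ M).Nonempty) : ∃ p ∈ L, p ∉ M ∧
      ∀ r ∈ L, r ∉ M → ∀ x ∈ arc M z q, x ∈ r → ¬ 0 < height p x * height p v := by
  have hQ := hL.pseudoline q (h.sub h.mem_right)
  by_cases hcr : {r ∈ L \ M | (r ∩ arc M z q).Nonempty}.Nonempty
  swap
  · obtain ⟨p, hp, hpM⟩ := hne
    refine ⟨p, hp, hpM, fun r hr hrM x hx hxr => absurd ⟨r, ⟨hr, hrM⟩, x, hxr, hx⟩ hcr⟩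
  -- The parameter on `q` of the crossing with `r`; the value 0 for an `r` that misses the edge is
  -- never used.
  have hc : ∀ r ∈ L \ M, ∃ t : ℝ, (r ∩ arc M z q).Nonempty → param q t ∈ r ∩ arc M z q ∧
      ∀ x ∈ r ∩ arc M z q, coord q x = t := by
    rintro r ⟨hr, hrM⟩
    by_cases hn : (r ∩ arc M z q).Nonempty
    · obtain ⟨x, hxr, hx⟩ := hn
      have hrq : r ≠ q := by rintro rfl; exact hrM h.mem_right
      obtain ⟨⟨u, hu⟩, -⟩ := hL.cross hr (h.sub h.mem_right) hrq
      refine ⟨coord q x, fun _ => ⟨by rw [hQ.param_coord hx.1]; exact ⟨hxr, hx⟩, fun y hy => ?_⟩⟩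
      have h1 : x ∈ r ∩ q := ⟨hxr, hx.1⟩
      have h2 : y ∈ r ∩ q := ⟨hy.1, hy.2.1⟩
      rw [hu, mem_singleton_iff] at h1 h2
      rw [h1, h2]
    · exact ⟨0, fun h => absurd h hn⟩
  choose! f hf using hc
  obtain ⟨p, ⟨⟨hp, hpM⟩, hpn⟩, hmin⟩ := Set.exists_min_image
    {r ∈ L \ M | (r ∩ arc M z q).Nonempty} (fun r => |f r - coord q v|)
    (hL.finite.subset fun r hr => hr.1.1) hcr
  refine ⟨p, hp, hpM, fun r hr hrM x hx hxr hpos => ?_⟩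
  have hrn : (r ∩ arc M z q).Nonempty := ⟨x, hxr, hx⟩
  have hle := hmin r ⟨⟨hr, hrM⟩, hrn⟩
  have hfp := (hf p ⟨hp, hpM⟩ hpn).1
  have hfx := (hf r ⟨hr, hrM⟩ hrn).2 x ⟨hxr, hx⟩
  have hvq := h.vertex_right hL.toIsArrangement
  have hvw := h.vertex_left hL.toIsArrangement
  simp only [← hfx] at hle
  have hpq : p ≠ q := by rintro rfl; exact hpM h.mem_right
  obtain ⟨t₀, ε, hε, h0, hs⟩ := hL.exists_height_param hp (h.sub h.mem_right) hpq
  obtain ⟨t₁, δ, hδ, h1, hs'⟩ := hL.exists_height_param (h.sub h.mem_left) (h.sub h.mem_right) h.ne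
  have ht₀ : f p = t₀ := by
    by_contra hne
    have := hs _ hne
    rw [(hL.pseudoline p hp).mem_iff.1 hfp.1, mul_zero] at this
    exact this.false
  have ht₁ : coord q v = t₁ := by
    by_contra hne
    have := hs' _ hne
    rw [hQ.param_coord hvq, (hL.pseudoline w (h.sub h.mem_left)).mem_iff.1 hvw, mul_zero] at this
    exact this.false
  -- the signs of the coordinates
  have e1 : 0 < (coord q x - f p) * (coord q v - f p) := by
    have hx0 := left_ne_zero_of_mul hpos.ne'
    have hv0 := right_ne_zero_of_mul hpos.ne'
    have hxt : coord q x ≠ t₀ := fun e => hx0 (by rw [← hQ.param_coord hx.1, e, h0])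
    have hvt : coord q v ≠ t₀ := fun e => hv0 (by rw [← hQ.param_coord hvq, e, h0])
    have s1 := hs _ hxt
    have s2 := hs _ hvt
    rw [hQ.param_coord hx.1] at s1
    rw [hQ.param_coord hvq] at s2
    rw [ht₀]
    have s3 : 0 < (ε * (coord q x - t₀)) * (ε * (coord q v - t₀)) :=
      mul_pos_trans (mul_pos_trans s1 hpos) (by rwa [mul_comm])
    have s4 : (ε * (coord q x - t₀)) * (ε * (coord q v - t₀)) =
      (coord q x - t₀) * (coord q v - t₀) * (ε * ε) := by ring
    rw [s4] at s3
    exact pos_of_mul_pos_left s3 (mul_self_nonneg ε)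
  have e2 : 0 < (coord q x - coord q v) * (f p - coord q v) := by
    have m1 := hx.2 w ⟨h.mem_left, h.ne⟩
    have m2 := hfp.2.2 w ⟨h.mem_left, h.ne⟩
    have hxt : coord q x ≠ t₁ := fun e =>
      left_ne_zero_of_mul m1.ne' (by rw [← hQ.param_coord hx.1, e, h1])
    have hft : f p ≠ t₁ := fun e => left_ne_zero_of_mul m2.ne' (by rw [e, h1])
    have s1 := hs' _ hxt
    have s2 := hs' _ hft
    rw [hQ.param_coord hx.1] at s1
    rw [ht₁]
    have s3 : 0 < (δ * (coord q x - t₁)) * (δ * (f p - t₁)) :=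
      mul_pos_trans (mul_pos_trans s1 m1) (by rw [mul_comm]; exact mul_pos_trans s2 m2)
    have s4 : (δ * (coord q x - t₁)) * (δ * (f p - t₁)) =
      (coord q x - t₁) * (f p - t₁) * (δ * δ) := by ring
    rw [s4] at s3
    exact pos_of_mul_pos_left s3 (mul_self_nonneg δ)
  -- By `e1`, `x` and `v` are on the same side of the crossing with `p`; by `e2`, `x` and that
  -- crossing are on the same side of `v`. So `x` lies strictly between them, against minimality.
  generalize coord q x = a at *
  generalize coord q v = b at *
  generalize f p = c at *
  rcases lt_or_ge 0 (c - b) with hc | hc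
  · have : 0 < a - b := pos_of_mul_pos_left e2 hc.le
    rw [abs_of_pos hc, abs_of_pos this] at hle
    nlinarith
  · have hc' : c - b < 0 := lt_of_le_of_ne hc (right_ne_zero_of_mul e2.ne')
    have : a - b < 0 := by nlinarith
    rw [abs_of_neg hc', abs_of_neg this] at hle
    nlinarith

/-! ### The induction on the missing pseudolines -/

lemma five_le_encard {α : Type*} {s : Set α} {a b c d e : α} (ha : a ∈ s) (hb : b ∈ s) (hc : c ∈ s)
    (hd : d ∈ s) (he : e ∈ s) (hab : a ≠ b) (hac : a ≠ c) (had : a ≠ d) (hae : a ≠ e) (hbc : b ≠ c)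
    (hbd : b ≠ d) (hbe : b ≠ e) (hcd : c ≠ d) (hce : c ≠ e) (hde : d ≠ e) : 5 ≤ s.encard := by
  classical
  have h : ((({a, b, c, d, e} : Finset α) : Set α)).encard = 5 := by
    rw [Set.encard_coe_eq_coe_finsetCard]
    simp [Finset.card_insert_of_notMem, *]
  rw [← h]
  refine encard_le_encard ?_
  intro x hx
  simp only [Finset.coe_insert, Finset.coe_singleton, mem_insert_iff, mem_singleton_iff] at hx
  rcases hx with rfl | rfl | rfl | rfl | rfl <;> assumption

/-- At an uncrossed corner of a cell of `M` with at least five edges there is a cell of `L` with at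
least five edges. -/
lemma Corner.exists_five_le_sides (hL : IsSimpleArrangement L) (h : Corner L M z w q v)
    (h5 : 5 ≤ (sides M z).encard) : ∃ z' ∈ region M z, (∀ r ∈ L, height r z' ≠ 0) ∧
      5 ≤ (sides L z').encard ∧ q ∈ sides L z' := by
  -- Strong induction, because the pentagon case adds two pseudolines at once.
  induction hn : (L \ M).ncard using Nat.strong_induction_on generalizing M z w q v with
  | _ n ih =>
  subst hn
  have hfin : (L \ M).Finite := hL.finite.subset sdiff_subset
  rcases (L \ M).eq_empty_or_nonempty with hne | hne
  · obtain rfl : M = L := h.sub.antisymm (sdiff_eq_empty.1 hne)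
    exact ⟨z, self_mem_region h.off, h.off, h5, h.right_mem_sides⟩
  obtain ⟨p, hp, hpM, hnear⟩ := h.exists_nearest hL hne
  have hL' := hL.toIsArrangement
  have hM := h.sub
  have hwp : w ≠ p := by rintro rfl; exact hpM h.mem_left
  have hqp : q ≠ p := by rintro rfl; exact hpM h.mem_right
  -- Only `q` has to persist; the uncrossed side and the vertex may change.
  have step : ∀ {z' : Plane} {w' : Set Plane} {v' : Plane}, z' ∈ region M z →
      Corner L (insert p M) z' w' q v' → 5 ≤ (sides (insert p M) z').encard →
      ∃ z' ∈ region M z, (∀ r ∈ L, height r z' ≠ 0) ∧ 5 ≤ (sides L z').encard ∧ q ∈ sides L z' := by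
    intro z' w' v' hz' hc hc5
    obtain ⟨y, hy, hy'⟩ := ih (L \ insert p M).ncard
      (ncard_lt_ncard ⟨sdiff_subset_sdiff_right (subset_insert _ _),
        fun hs => (hs ⟨hp, hpM⟩).2 (mem_insert _ _)⟩ hfin) hc hc5 rfl
    exact ⟨y, region_insert_subset hz' hy, hy'⟩
  obtain ⟨z₁, hz₁, hp₁, hv₁, h₁⟩ := h.exists_insert hL hp hpM
  by_cases h5₁ : 5 ≤ (sides (insert p M) z₁).encard
  · exact step hz₁ h₁ h5₁
  -- the cell at the corner is a quadrangle
  have hmeet : (p ∩ region M z).Nonempty := by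
    rw [nonempty_iff_ne_empty]
    intro h0
    exact h5₁ (h5.trans (encard_le_encard
      (hL.sides_subset_sides_insert hM h.off hp hpM h0 hz₁)))
  have hw₁ : ∀ {r}, r ∈ L → (r ∩ arc M z w).Nonempty → r = w := fun {r} hr hn => by
    by_contra hne
    rw [h.uncrossed r hr hne] at hn
    exact not_nonempty_empty hn
  obtain ⟨c, hcp, hc⟩ := hmeet
  have hpS := self_mem_sides_insert hpM hcp hc hz₁
  have hsides : ∀ {r}, r ∈ M → (p ∩ arc M z r).Nonempty → ∀ {z'}, z' ∈ region M z →
      height p z' ≠ 0 → r ∈ sides (insert p M) z' := by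
    rintro r hr ⟨x, hxp, hx⟩ z' hz' hp'
    exact hL.mem_sides_insert hM hp hpM hr hxp hx hz' hp'
  obtain ⟨b, hbM, hbq, hqn, hbn, hS⟩ : ∃ b ∈ M, b ≠ q ∧ (p ∩ arc M z q).Nonempty ∧
      (p ∩ arc M z b).Nonempty ∧
      ∀ r ∈ sides (insert p M) z₁, r = p ∨ r = w ∨ r = q ∨ r = b := by
    obtain ⟨a, ha, b, hb, hab, hpa, hpb, -⟩ :=
      hL.exists_two_crossed_arcs hM h.off h.bounded hp hpM ⟨c, hcp, hc⟩
    have haw : w ≠ a := by rintro rfl; exact hwp.symm (hw₁ hp hpa)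
    have hbw : w ≠ b := by rintro rfl; exact hwp.symm (hw₁ hp hpb)
    have hap : p ≠ a := by rintro rfl; exact hpM ha
    have hbp : p ≠ b := by rintro rfl; exact hpM hb
    have hS : ∀ r ∈ sides (insert p M) z₁, r = p ∨ r = w ∨ r = a ∨ r = b := by
      intro r hr
      by_contra! hne
      exact h5₁ (five_le_encard hr hpS h₁.left_mem_sides (hsides ha hpa hz₁ hp₁)
        (hsides hb hpb hz₁ hp₁) hne.1 hne.2.1 hne.2.2.1 hne.2.2.2 hwp.symm hap hbp haw hbw hab)
    rcases hS q h₁.right_mem_sides with e | e | rfl | rfl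
    · exact absurd e hqp
    · exact absurd e h.ne.symm
    · exact ⟨b, hb, hab.symm, hpa, hpb, hS⟩
    · refine ⟨a, ha, hab, hpb, hpa, fun r hr => ?_⟩
      rcases hS r hr with h | h | h | h <;> simp [h]
  have hbw : b ≠ w := by rintro rfl; exact hwp.symm (hw₁ hp hbn)
  have hbp : b ≠ p := by rintro rfl; exact hpM hbM
  by_cases hunc : ∀ r ∈ L, r ≠ p → r ∩ (p ∩ region M z) = ∅
  · -- the other part of the cell has as many edges, and an uncrossed edge on `p`
    obtain ⟨z₂, hz₂, hp₂⟩ := hL.exists_mem_region_side hM hp hcp hc (neg_ne_zero.2 hp₁)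
    have hp₂' : height p z₂ ≠ 0 := left_ne_zero_of_mul hp₂.ne'
    obtain ⟨v₂, hv₂p, hv₂⟩ := hqn
    have hc₂ : Corner L (insert p M) z₂ p q v₂ := by
      refine ⟨insert_subset hp hM, ?_, h.bounded.subset (region_insert_subset hz₂), mem_insert _ _,
        mem_insert_of_mem _ h.mem_right, hqp.symm, ?_, ?_, ?_⟩
      · rintro r (rfl | hr)
        · exact hp₂'
        · exact height_ne_zero_of_mem_region hz₂ r hr
      · rw [arc_insert_self hz₂ hpM]
        exact hL.mem_closure_of_mem_arc hM h.off hp hpM h.mem_right hv₂p hv₂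
      · rw [arc_insert_eq hz₂ hqp]
        exact hL.mem_closure_arc_inter hM hp hpM h.mem_right hv₂p hv₂ hp₂'
      · rw [arc_insert_self hz₂ hpM]; exact hunc
    refine step hz₂ hc₂ ?_
    -- A side that `p` does not cross and that lies towards `v` would be a side of the quadrangle
    -- other than `p`, `q`, `b`, hence `w`.
    have hsub : insert p (sides M z \ {w}) ⊆ sides (insert p M) z₂ := by
      rintro r (rfl | ⟨hr, hrw⟩)
      · exact hc₂.left_mem_sides
      by_cases hrn : (p ∩ arc M z r).Nonempty
      · exact hsides hr.1 hrn hz₂ hp₂'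
      obtain ⟨x, hx⟩ := hr.2
      have hrp : r ≠ p := by rintro rfl; exact hpM hr.1
      have hxp : height p x ≠ 0 := fun h0 =>
        hrn ⟨x, (hL.pseudoline p hp).mem_iff.2 h0, hx⟩
      refine ⟨mem_insert_of_mem _ hr.1, x, ?_⟩
      rw [arc_insert_eq hz₂ hrp]
      refine ⟨hx, ?_⟩
      by_contra hneg
      have hx₁ : 0 < height p x * height p z₁ := by
        have hneg : height p x * height p z₂ ≤ 0 := not_lt.1 hneg
        by_contra! h'
        have h'' := lt_of_le_of_ne h' (mul_ne_zero hxp hp₁)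
        have h3 : 0 < height p x * -height p z₁ := by linarith
        exact absurd (mul_pos_trans h3 (by rw [mul_comm]; exact hp₂)) hneg.not_gt
      have hrS : r ∈ sides (insert p M) z₁ :=
        ⟨mem_insert_of_mem _ hr.1, x, by rw [arc_insert_eq hz₁ hrp]; exact ⟨hx, hx₁⟩⟩
      rcases hS r hrS with e | e | rfl | rfl
      · exact hrp e
      · exact hrw e
      · exact hrn ⟨v₂, hv₂p, hv₂⟩
      · exact hrn hbn
    refine h5.trans (le_trans ?_ (encard_le_encard hsub))
    rw [encard_insert_of_notMem (fun hm => hpM hm.1.1),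
      encard_sdiff_singleton_add_one h.left_mem_sides]
  · -- a pseudoline that crosses the edge on `p` cuts off a pentagon
    push Not at hunc
    obtain ⟨p', hp', hpp', x, hxp', hxp, hx⟩ := hunc
    have hpN : p' ∉ insert p M := by
      rintro (e | hm)
      · exact hpp' e
      · exact notMem_region (hL.toIsArrangement.mono hM) hm hxp' hx
    have hpM' : p' ∉ M := fun hm => hpN (mem_insert_of_mem _ hm)
    obtain ⟨z₃, hz₃, hp₃, hv₃, h₃⟩ := h₁.exists_insert hL hp' hpN
    have hxarc : x ∈ arc (insert p M) z₁ p := by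
      rw [arc_insert_self hz₁ hpM]; exact ⟨hxp, hx⟩
    obtain ⟨b', hb'N, hb'p, hb'n, -⟩ := hL.exists_other_crossed_arc h₁.sub h₁.off h₁.bounded hp' hpN
      (mem_insert p M) ⟨x, hxp', hxarc⟩
    -- The exit from the quadrangle is not on `w`, which is uncrossed, nor on `q`, by the choice of
    -- `p`.
    have hb' : b' = b := by
      rcases hS b' ⟨hb'N, hb'n.mono inter_subset_right⟩ with e | e | e | e
      · exact absurd e hb'p
      · subst e
        rw [h₁.uncrossed p' hp' (by rintro rfl; exact hpN hb'N)] at hb'n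
        exact absurd hb'n not_nonempty_empty
      · subst e
        obtain ⟨u, hup', hu⟩ := hb'n
        rw [arc_insert_eq hz₁ hqp] at hu
        exact absurd (mul_pos_trans hu.2 (by rw [mul_comm]; exact hv₁))
          (hnear p' hp' hpM' u hu.1 hup')
      · exact e
    subst hb'
    obtain ⟨u, hup', hu⟩ := hb'n
    have hne' : ∀ {r}, r ∈ insert p M → p' ≠ r := by rintro r hr rfl; exact hpN hr
    have hself : p' ∈ sides (insert p' (insert p M)) z₃ := by
      obtain ⟨y, hyp, hy⟩ := closure_nonempty_iff.1
        ⟨x, hL.mem_closure_of_mem_arc h₁.sub h₁.off hp' hpN (mem_insert p M) hxp' hxarc⟩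
      exact self_mem_sides_insert hpN hyp hy hz₃
    have h5₃ : 5 ≤ (sides (insert p' (insert p M)) z₃).encard :=
      five_le_encard hself (hL.mem_sides_insert h₁.sub hp' hpN (mem_insert p M) hxp' hxarc hz₃ hp₃)
        (hL.mem_sides_insert h₁.sub hp' hpN hb'N hup' hu hz₃ hp₃) h₃.left_mem_sides
        h₃.right_mem_sides (hne' (mem_insert p M)) (hne' hb'N) (hne' h₁.mem_left)
        (hne' h₁.mem_right) hbp.symm hwp.symm hqp.symm hbw hbq h.ne
    obtain ⟨y, hy, hy'⟩ := ih (L \ insert p' (insert p M)).ncard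
      (ncard_lt_ncard ⟨sdiff_subset_sdiff_right ((subset_insert _ _).trans (subset_insert _ _)),
        fun hs => (hs ⟨hp, hpM⟩).2 (mem_insert_of_mem _ (mem_insert _ _))⟩ hfin) h₃ h5₃ rfl
    exact ⟨y, region_insert_subset hz₁ (region_insert_subset hz₃ hy), hy'⟩

end PseudolineArrangement

/-! ### From sign regions back to polygons -/

open PseudolineArrangement Set in
theorem mainTheorem8
    (L M : Set (Set PseudolineArrangement.Plane))
    (hL : PseudolineArrangement.IsSimpleArrangement L)
    (hM : M ⊆ L)
    (Q : Set PseudolineArrangement.Plane)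
    (hQ : PseudolineArrangement.IsGeFiveGon M Q)
    (w : Set PseudolineArrangement.Plane)
    (hw : w ∈ PseudolineArrangement.edgesOf M Q)
    (hwL : ∀ p ∈ L, ¬ PseudolineArrangement.CrossesEdge p w) :
    ∀ q ∈ PseudolineArrangement.edgesOf M Q, PseudolineArrangement.AdjacentEdges q w →
      ∃ R : Set PseudolineArrangement.Plane, PseudolineArrangement.IsGeFiveGon L R ∧ R ⊆ Q ∧
        ∃ e ∈ PseudolineArrangement.edgesOf L R, e ⊆ q := by
  intro q hq hadj
  have hL' := hL.toIsArrangement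
  have hMa := hL'.mono hM
  have hQ' := hQ
  obtain ⟨-, -, ⟨⟨z, hz, rfl⟩, -⟩, -⟩ := hQ'
  have hoff := (hMa.notMem_sUnion_iff Subset.rfl).1 hz
  rw [hMa.connectedComponentIn_eq_region hoff] at hQ hw hq ⊢
  rw [hMa.edgesOf_region hoff] at hw hq
  obtain ⟨w, hw, rfl⟩ := hw
  obtain ⟨q, hq, rfl⟩ := hq
  obtain ⟨hb, h5⟩ := (hMa.isGeFiveGon_region hoff).1 hQ
  obtain ⟨hne, v, hvq, hvw⟩ := hadj
  have hc : Corner L M z w q v := by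
    refine ⟨hM, hoff, hb, hw.1, hq.1, fun e => hne (by rw [e]), hvw, hvq, fun r hr hrw => ?_⟩
    by_contra hn
    rw [← ne_eq, ← nonempty_iff_ne_empty] at hn
    -- Not crossing the edge leaves the possibility of containing it, but near a common point `w`
    -- leaves `r`.
    have hsub : arc M z w ⊆ r := by
      by_contra hs
      exact hwL r hr ⟨hn, hs⟩
    obtain ⟨x, hxr, hx⟩ := hn
    obtain ⟨y, hyU, hyw, hy⟩ := hL'.exists_near_crossing hr (hM hw.1) hrw hxr hx.1
      ((hL'.isOpen_region_sdiff hM {w} z).mem_nhds hx.2) one_ne_zero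
    rw [(hL'.pseudoline r hr).mem_iff.1 (hsub ⟨hyw, hyU⟩), zero_mul] at hy
    exact hy.false
  obtain ⟨z', hz', hoff', h5', hq'⟩ := hc.exists_five_le_sides hL h5
  have hsub : ∀ {N K : Set (Set Plane)}, N ⊆ K → z' ∈ region N z → region K z' ⊆ region N z :=
    fun h h' => region_eq h' ▸ region_mono h z'
  refine ⟨region L z', (hL'.isGeFiveGon_region hoff').2 ⟨hb.subset (hsub hM hz'), h5'⟩,
    hsub hM hz', arc L z' q, ?_, ?_⟩
  · rw [hL'.edgesOf_region hoff']; exact mem_image_of_mem _ hq'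
  · exact inter_subset_inter_right _ (hsub (sdiff_subset_sdiff_left hM)
      (region_mono sdiff_subset z hz'))
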